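/- Let $a$ be a letter of a finite alphabet $\Sigma$ and let $f$ be a strictly increasing function from the positive integers to the non-negative integers. If the language $L=\{a^{f(n)} : n\ge 1\}$ is an indexed language, then $f(n)=O(k^n)$ as $n\to\infty$ for some positive integer $k$. Here a language over $\Sigma$ is indexed if it is generated by an indexed grammar: a finite set $N$ of nonterminals with a start symbol $S\in N$, a finite set $F$ of indices, and a finite set of productions of the forms $A\to\alpha$, $A\to B\varphi$, $A\varphi\to\alpha$ with $A,B\in N$, $\varphi\in F$, $\alpha\in(N\cup\Sigma)^*$. Productions rewrite words in $(NF^*\cup\Sigma)^*$: for every $\omega\in F^*$ they replace an occurrence of $A\omega$ (where $\omega$ is the whole index string of that occurrence of $A$) by $\alpha\cdot\omega$, replace $A\omega$ by $B\varphi\omega$, and replace $A\varphi\omega$ by $\alpha\cdot\omega$, respectively, where $\alpha\cdot\omega$ is obtained from $\alpha$ by writing $\omega$ after every nonterminal in it. The language generated consists of all words in $\Sigma^*$ derivable from $S$ in finitely many steps. -/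

import Mathlib

/-- The productions of an indexed grammar with terminals `T`, nonterminals `N` and indices `I`,
where `A B : N`, `f : I` and `α` is a word over `N ∪ T`. -/
inductive IndexedRule (T N I : Type*) where
  /-- The production `A → α`. -/
  | rewrite (A : N) (α : List (Symbol T N)) : IndexedRule T N I
  /-- The production `A → B f`. -/
  | push (A B : N) (f : I) : IndexedRule T N I
  /-- The production `A f → α`. -/
  | pop (A : N) (f : I) (α : List (Symbol T N)) : IndexedRule T N I

/-- An indexed grammar over the terminal alphabet `T`: finitely many nonterminals, finitely many
indices, a start symbol and finitely many productions. -/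
structure IndexedGrammar (T : Type*) where
  /-- The nonterminals. -/
  NT : Type
  /-- The indices. -/
  Idx : Type
  finite_NT : Finite NT
  finite_Idx : Finite Idx
  /-- The start symbol. -/
  initial : NT
  /-- The productions. -/
  rules : Finset (IndexedRule T NT Idx)

/-- Attach the index string `δ` to a symbol: a nonterminal `X` becomes `X δ`, and a terminal
is left alone. -/
def Symbol.attachIndices {T N I : Type*} (δ : List I) : Symbol T N → Symbol T (N × List I)
  | .terminal t => .terminal t
  | .nonterminal X => .nonterminal (X, δ)

namespace IndexedGrammar

/-- Sentential forms: words whose letters are terminals or nonterminals followed by a string of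
indices (the first entry of the list is the index next to the nonterminal). -/
abbrev SententialForm {T : Type*} (g : IndexedGrammar T) : Type _ :=
  List (Symbol T (g.NT × List g.Idx))

/-- `g.Expands A ω γ`: one production of `g` turns the nonterminal `A` with index string `ω`
into the sentential form `γ`. The remaining indices are copied to every nonterminal on the
right-hand side of the production. -/
inductive Expands {T : Type*} (g : IndexedGrammar T) :
    g.NT → List g.Idx → g.SententialForm → Prop
  | rewrite {A : g.NT} {α : List (Symbol T g.NT)} (δ : List g.Idx)
      (h : IndexedRule.rewrite A α ∈ g.rules) :
      Expands g A δ (α.map (Symbol.attachIndices δ))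
  | push {A B : g.NT} {f : g.Idx} (δ : List g.Idx)
      (h : IndexedRule.push A B f ∈ g.rules) :
      Expands g A δ [Symbol.nonterminal (B, f :: δ)]
  | pop {A : g.NT} {f : g.Idx} {α : List (Symbol T g.NT)} (δ : List g.Idx)
      (h : IndexedRule.pop A f α ∈ g.rules) :
      Expands g A (f :: δ) (α.map (Symbol.attachIndices δ))

/-- One derivation step: a single nonterminal with its index string is expanded in place. -/
def Produces {T : Type*} (g : IndexedGrammar T) (u v : g.SententialForm) : Prop :=
  ∃ (p q γ : g.SententialForm) (A : g.NT) (ω : List g.Idx), g.Expands A ω γ ∧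
    u = p ++ [Symbol.nonterminal (A, ω)] ++ q ∧ v = p ++ γ ++ q

/-- Derivability in finitely many steps. -/
def Derives {T : Type*} (g : IndexedGrammar T) : g.SententialForm → g.SententialForm → Prop :=
  Relation.ReflTransGen g.Produces

/-- The language generated by `g`: the terminal words derivable from the start symbol with empty
index string. -/
def language {T : Type*} (g : IndexedGrammar T) : Language T :=
  {w : List T | g.Derives [Symbol.nonterminal (g.initial, [])] (w.map Symbol.terminal)}

end IndexedGrammar

/-- A language is indexed if it is generated by an indexed grammar. -/
def Language.IsIndexed {T : Type*} (L : Language T) : Prop :=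
  ∃ g : IndexedGrammar T, g.language = L

/-! ### Lists -/

/-! A long word of an indexed language can be shortened within the language without losing more than
a constant factor in length (`exists_sublist_mem_language`). When the words are powers of a with
strictly increasing exponents f(n), a shorter word has length at most f(n-1), so f(n) ≤ K f(n-1) as
soon as f(n) > K, and f grows at most exponentially.

A residue of a letter over ω is what a derivation leaving ω unconsumed produces, up to erasing
letters that vanish. Being a residue depends on ω only through the set of vanishing letters
(`Residue.of_vanishes`), so only finitely many languages of residues occur, and Higman's lemma
yields one bound K for shrinking any residue while keeping a marked letter (`exists_residue_bound`).

To shrink a long residue, descend into its derivation until a residue of length between K and K·M·K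
appears, where M bounds the right-hand sides of productions. Mark its letter contributing most to
the final word and shrink there only: at most a factor K·M·K is lost (`Residue.exists_shrinks`).
This applies to the language because its nonempty words are residues of the start symbol over the
empty index string (`residue_of_mem_language`). -/

namespace List

/-- Higman's lemma for words over a finite alphabet, in the form: every word in a set of words
contains a subword of bounded length which lies in the set. -/
theorem exists_bound_sublist_mem {α : Type*} [Finite α] (Q : Set (List α)) :
    ∃ K : ℕ, ∀ l ∈ Q, ∃ l' ∈ Q, l'.Sublist l ∧ l'.length ≤ K := by
  by_contra! h
  choose s hsQ hs using h
  have hwqo := Set.PartiallyWellOrderedOn.partiallyWellOrderedOn_sublistForall₂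
    (· = ·) (Set.finite_univ (α := α)).partiallyWellOrderedOn
  -- No subword of `v (n + 1)` lying in `Q` has length at most that of `v n`. Hence `v i` cannot
  -- embed in a later `v j`, contradicting Higman's lemma.
  let v : ℕ → List α := fun n => Nat.rec (s 0) (fun _ l => s l.length) n
  have hv : StrictMono fun n => (v n).length :=
    strictMono_nat_of_lt_succ fun n => hs (v n).length _ (hsQ _) (Sublist.refl _)
  have hvQ : ∀ n, v n ∈ Q := fun n => by cases n <;> exact hsQ _
  obtain ⟨i, j, hij, hsub⟩ := hwqo.exists_lt (f := v) (fun n x _ => Set.mem_univ x)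
  obtain ⟨l, hl, hlj⟩ := sublistForall₂_iff.1 hsub
  rw [forall₂_eq_eq_eq] at hl
  subst hl
  obtain ⟨j, rfl⟩ : ∃ k, j = k + 1 := ⟨j - 1, by omega⟩
  have h1 : (v j).length < (v i).length := hs _ _ (hvQ i) hlj
  have h2 : (v i).length ≤ (v j).length := hv.monotone (by omega)
  omega

/-- Labels distinguish occurrences of equal letters; this pulls a factorization of the underlying
word back to the labelled word. -/
theorem exists_flatMap_of_map_eq {ι κ X β : Type*} {p : X → β} {h : ι → List β} {F : κ → ι}
    {G : κ → List X} (H : ∀ i v, v.map p = h i → ∃ j, F j = i ∧ G j = v) :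
    ∀ (L : List ι) (v : List X), v.map p = L.flatMap h →
      ∃ L' : List κ, L'.map F = L ∧ L'.flatMap G = v
  | [], v, hv => ⟨[], rfl, by simpa using hv.symm⟩
  | i :: L, v, hv => by
    rw [flatMap_cons, map_eq_append_iff] at hv
    obtain ⟨v₁, v₂, rfl, h₁, h₂⟩ := hv
    obtain ⟨j, rfl, rfl⟩ := H _ _ h₁
    obtain ⟨L', rfl, rfl⟩ := exists_flatMap_of_map_eq H L v₂ h₂
    exact ⟨j :: L', rfl, rfl⟩

theorem exists_labels_of_map_eq_flatMap_snd {X α β : Type*} {p : X → β} (L : List (α × List β))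
    (v : List X) (hv : v.map p = L.flatMap Prod.snd) :
    ∃ L' : List (α × List X), L'.map (Prod.map id (map p)) = L ∧ L'.flatMap Prod.snd = v :=
  exists_flatMap_of_map_eq (fun i w hw => ⟨(i.1, w), Prod.ext rfl hw, rfl⟩) L v hv

theorem length_flatMap_le {α β : Type*} {f : α → List β} {K : ℕ} :
    ∀ l : List α, (∀ x ∈ l, (f x).length ≤ K) → (l.flatMap f).length ≤ l.length * K
  | [], _ => by simp
  | x :: l, h => by
    have h1 := h x (by simp)
    have h2 := length_flatMap_le l fun y hy => h y (by simp [hy])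
    simp only [flatMap_cons, length_append, length_cons]
    linarith

theorem exists_sum_map_le_length_mul {α : Type*} (w : α → ℕ) :
    ∀ l : List α, l ≠ [] → ∃ x ∈ l, (l.map w).sum ≤ l.length * w x
  | [x], _ => ⟨x, by simp⟩
  | x :: y :: l, _ => by
    obtain ⟨z, hz, hs⟩ := exists_sum_map_le_length_mul w (y :: l) (by simp)
    rcases le_total (w x) (w z) with h | h
    · refine ⟨z, mem_cons_of_mem _ hz, ?_⟩
      rw [map_cons, sum_cons, length_cons (a := x)]
      linarith
    · refine ⟨x, by simp, ?_⟩
      rw [map_cons, sum_cons, length_cons (a := x)]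
      have := Nat.mul_le_mul_left (y :: l).length h
      linarith

/-- `l'` is a proper subword of `l` which keeps at least a `K`-th of the total weight. -/
structure Shrinks {X : Type*} (K : ℕ) (w : X → ℕ) (l l' : List X) : Prop where
  sublist : l'.Sublist l
  length_lt : l'.length < l.length
  sum_le : (l.map w).sum ≤ K * (l'.map w).sum

/-- The unchanged context keeps all its weight, so the factor does not deteriorate. -/
theorem Shrinks.append {X : Type*} {K : ℕ} (hK : 1 ≤ K) {w : X → ℕ} {l l' : List X}
    (h : Shrinks K w l l') (p q : List X) : Shrinks K w (p ++ (l ++ q)) (p ++ (l' ++ q)) where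
  sublist := (Sublist.refl p).append (h.sublist.append (Sublist.refl q))
  length_lt := by simpa using h.length_lt
  sum_le := by
    have h1 := Nat.mul_le_mul_right (p.map w).sum hK
    have h2 := Nat.mul_le_mul_right (q.map w).sum hK
    have h3 := h.sum_le
    simp only [map_append, sum_append, mul_add]
    omega

theorem Sublist.length_flatMap_lt {α β : Type*} {f : α → List β} {l' l : List α}
    (h : l'.Sublist l) : l'.length < l.length → (∀ x ∈ l, f x ≠ []) →
      (l'.flatMap f).length < (l.flatMap f).length := by
  induction h with
  | slnil => simp
  | cons a h ih =>
    intro _ hf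
    have h1 := (h.flatMap f).length_le
    have h2 := length_pos_iff.2 (hf a (by simp))
    simp only [flatMap_cons, length_append]
    omega
  | cons_cons a h ih =>
    intro hl hf
    have := ih (by simpa using hl) fun x hx => hf x (by simp [hx])
    simp only [flatMap_cons, length_append]
    omega

theorem sum_map_flatMap {α β : Type*} (f : α → List β) (w : β → ℕ) (l : List α) :
    ((l.flatMap f).map w).sum = (l.map fun x => ((f x).map w).sum).sum := by
  induction l with
  | nil => rfl
  | cons a l ih => simp [ih]

/-- Each letter is weighted by its whole block; nonempty blocks make the deletion of a letter a
strict shortening. -/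
theorem Shrinks.flatMap {X Y : Type*} {K : ℕ} {w : X → ℕ} {f : Y → List X} {l l' : List Y}
    (h : Shrinks K (fun y => ((f y).map w).sum) l l') (hf : ∀ y ∈ l, f y ≠ []) :
    Shrinks K w (l.flatMap f) (l'.flatMap f) where
  sublist := h.sublist.flatMap f
  length_lt := h.sublist.length_flatMap_lt h.length_lt hf
  sum_le := by simpa only [sum_map_flatMap] using h.sum_le

end List

namespace IndexedGrammar

variable {T : Type*} {g : IndexedGrammar T}

/-! ### Derivation trees -/

/-- `g.Yield s w`: there is a derivation tree with root `s` and yield `w`. -/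
inductive Yield (g : IndexedGrammar T) : Symbol T (g.NT × List g.Idx) → List T → Prop
  | terminal (t : T) : Yield g (.terminal t) [t]
  | expand {A : g.NT} {ω : List g.Idx} {γ : g.SententialForm}
      (L : List (Symbol T (g.NT × List g.Idx) × List T)) (h : g.Expands A ω γ)
      (hγ : L.map Prod.fst = γ) (hL : ∀ x ∈ L, Yield g x.1 x.2) :
      Yield g (.nonterminal (A, ω)) (L.flatMap Prod.snd)

theorem Derives.append {u u' v v' : g.SententialForm} (h : g.Derives u u') (h' : g.Derives v v') :
    g.Derives (u ++ v) (u' ++ v') := by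
  refine Relation.ReflTransGen.trans (b := u' ++ v) ?_ ?_
  · refine Relation.ReflTransGen.lift (r := g.Produces) (· ++ v) ?_ _ _ h
    rintro _ _ ⟨p, q, γ, A, ω, hA, rfl, rfl⟩
    exact ⟨p, q ++ v, γ, A, ω, hA, by simp, by simp⟩
  · refine Relation.ReflTransGen.lift (r := g.Produces) (u' ++ ·) ?_ _ _ h'
    rintro _ _ ⟨p, q, γ, A, ω, hA, rfl, rfl⟩
    exact ⟨u' ++ p, q, γ, A, ω, hA, by simp, by simp⟩

theorem Derives.flatMap {ι : Type*} {a : ι → Symbol T (g.NT × List g.Idx)}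
    {b : ι → g.SententialForm} :
    ∀ L : List ι, (∀ x ∈ L, g.Derives [a x] (b x)) → g.Derives (L.map a) (L.flatMap b)
  | [], _ => Relation.ReflTransGen.refl
  | x :: L, h => by
    have := (h x (by simp)).append (Derives.flatMap L fun y hy => h y (by simp [hy]))
    simpa using this

theorem Expands.produces {A : g.NT} {ω : List g.Idx} {γ : g.SententialForm}
    (h : g.Expands A ω γ) : g.Produces [.nonterminal (A, ω)] γ :=
  ⟨[], [], γ, A, ω, h, by simp, by simp⟩

theorem Yield.derives {s : Symbol T (g.NT × List g.Idx)} {w : List T} (h : g.Yield s w) :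
    g.Derives [s] (w.map Symbol.terminal) := by
  induction h with
  | terminal t => exact Relation.ReflTransGen.refl
  | expand L h hγ _ ih =>
    subst hγ
    refine Relation.ReflTransGen.head h.produces ?_
    rw [List.map_flatMap]
    exact Derives.flatMap L ih

theorem Derives.exists_yield {γ : g.SententialForm} {w : List T}
    (h : g.Derives γ (w.map Symbol.terminal)) :
    ∃ L : List (Symbol T (g.NT × List g.Idx) × List T),
      L.map Prod.fst = γ ∧ L.flatMap Prod.snd = w ∧ ∀ x ∈ L, g.Yield x.1 x.2 := by
  induction h using Relation.ReflTransGen.head_induction_on with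
  | refl =>
    refine ⟨w.map fun t => (.terminal t, [t]), by simp, by simp [List.flatMap_map], ?_⟩
    simp only [List.mem_map, forall_exists_index, and_imp]
    rintro _ t _ rfl
    exact Yield.terminal t
  | head h _ ih =>
    obtain ⟨p, q, γ, A, ω, hA, rfl, rfl⟩ := h
    obtain ⟨L, hL, rfl, hy⟩ := ih
    rw [List.map_eq_append_iff] at hL
    obtain ⟨L₁₂, L₃, rfl, hL, rfl⟩ := hL
    rw [List.map_eq_append_iff] at hL
    obtain ⟨L₁, L₂, rfl, rfl, rfl⟩ := hL
    refine ⟨L₁ ++ [(.nonterminal (A, ω), L₂.flatMap Prod.snd)] ++ L₃, by simp, by simp, ?_⟩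
    simp only [List.mem_append, List.mem_singleton] at hy ⊢
    rintro x ((hx | rfl) | hx)
    · exact hy x (.inl (.inl hx))
    · exact Yield.expand L₂ hA rfl fun x hx => hy x (.inl (.inr hx))
    · exact hy x (.inr hx)

/-- `g.Vanishes ω c`: the letter `c` with index string `ω` derives the empty word. -/
def Vanishes (g : IndexedGrammar T) (ω : List g.Idx) (c : Symbol T g.NT) : Prop :=
  g.Yield (c.attachIndices ω) []

/-- A derivation of the empty word can be copied over `ω'` as long as it works inside `δ`; once `δ`
is used up, the remaining subtree is replaced by means of `h`. -/
theorem vanishes_append_of_forall {ω ω' : List g.Idx} (h : ∀ c, g.Vanishes ω c → g.Vanishes ω' c)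
    (δ : List g.Idx) (c : Symbol T g.NT) (hc : g.Vanishes (δ ++ ω) c) :
    g.Vanishes (δ ++ ω') c := by
  have key : ∀ s w, g.Yield s w → w = [] → ∀ (c : Symbol T g.NT) (δ : List g.Idx),
      s = c.attachIndices (δ ++ ω) → g.Vanishes (δ ++ ω') c := by
    intro s w hs
    induction hs with
    | terminal t => simp
    | @expand A θ γ L hA hγ hL ih =>
      intro hw c δ hc
      rw [List.flatMap_eq_nil_iff] at hw
      obtain _ | A := c
      · simp [Symbol.attachIndices] at hc
      simp only [Symbol.attachIndices, Symbol.nonterminal.injEq, Prod.mk.injEq] at hc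
      obtain ⟨rfl, rfl⟩ := hc
      have close : ∀ (α : List (Symbol T g.NT)) (ε : List g.Idx),
          α.map (Symbol.attachIndices (ε ++ ω)) = L.map Prod.fst →
          g.Expands A (δ ++ ω') (α.map (Symbol.attachIndices (ε ++ ω'))) →
          g.Vanishes (δ ++ ω') (.nonterminal A) := by
        intro α ε hα hA
        have hy := Yield.expand (α.map fun c => (c.attachIndices (ε ++ ω'), [])) hA (by simp) ?_
        · have hnil : (α.map fun c : Symbol T g.NT => (c.attachIndices (ε ++ ω'), ([] : List T))
            ).flatMap Prod.snd = [] := by simp [List.flatMap_map]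
          rwa [hnil] at hy
        · simp only [List.mem_map, forall_exists_index, and_imp]
          rintro _ c hc rfl
          have : c.attachIndices (ε ++ ω) ∈ L.map Prod.fst := hα ▸ List.mem_map_of_mem hc
          obtain ⟨x, hx, hxc⟩ := List.mem_map.1 this
          exact ih x hx (hw x hx) c ε hxc
      have hyield : g.Yield (.nonterminal (A, δ ++ ω)) (L.flatMap Prod.snd) :=
        Yield.expand L hA hγ hL
      rw [List.flatMap_eq_nil_iff.2 hw] at hyield
      generalize hθ : δ ++ ω = θ at hA
      cases hA with
      | @rewrite α _ hr =>
        subst hθ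
        exact close α δ hγ.symm (.rewrite _ hr)
      | @push B f _ hr =>
        subst hθ
        exact close [.nonterminal B] (f :: δ) hγ.symm (.push _ hr)
      | @pop f α θ hr =>
        cases δ with
        | nil => exact h _ hyield
        | cons f' δ =>
          obtain ⟨rfl, rfl⟩ := List.cons.inj hθ
          exact close α δ hγ.symm (.pop _ hr)
  exact key _ _ hc rfl c δ rfl

/-! ### Residues -/

/-- `g.PopsTo f c β`: removing the index `f` next to the letter `c` turns `c` into `β`; terminals
are left alone. -/
inductive PopsTo (g : IndexedGrammar T) (f : g.Idx) :
    Symbol T g.NT → List (Symbol T g.NT) → Prop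
  | terminal (t : T) : PopsTo g f (.terminal t) [.terminal t]
  | pop {A : g.NT} {β : List (Symbol T g.NT)} (h : IndexedRule.pop A f β ∈ g.rules) :
      PopsTo g f (.nonterminal A) β

/-- `g.Residue ω c u`: the letter `c` with index string `ω` derives, without consuming any index
of `ω`, a form which becomes `u` with `ω` attached when some nonterminals which vanish are erased.
Here `u` and the contribution of each nonterminal which is not erased are nonempty. -/
inductive Residue (g : IndexedGrammar T) :
    List g.Idx → Symbol T g.NT → List (Symbol T g.NT) → Prop
  | refl (ω : List g.Idx) (c : Symbol T g.NT) : Residue g ω c [c]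
  | rewrite {ω : List g.Idx} {A : g.NT} (L : List (Symbol T g.NT × List (Symbol T g.NT)))
      (h : IndexedRule.rewrite A (L.map Prod.fst) ∈ g.rules)
      (hL : ∀ x ∈ L, x.2 ≠ [] → Residue g ω x.1 x.2)
      (hL' : ∀ x ∈ L, x.2 = [] → g.Vanishes ω x.1)
      (hne : L.flatMap Prod.snd ≠ []) :
      Residue g ω (.nonterminal A) (L.flatMap Prod.snd)
  | push {ω : List g.Idx} {A B : g.NT} {f : g.Idx}
      (L : List (Symbol T g.NT × List (Symbol T g.NT × List (Symbol T g.NT))))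
      (h : IndexedRule.push A B f ∈ g.rules)
      (hB : Residue g (f :: ω) (.nonterminal B) (L.map Prod.fst))
      (hpop : ∀ y ∈ L, g.PopsTo f y.1 (y.2.map Prod.fst))
      (hL : ∀ y ∈ L, ∀ x ∈ y.2, x.2 ≠ [] → Residue g ω x.1 x.2)
      (hL' : ∀ y ∈ L, ∀ x ∈ y.2, x.2 = [] → g.Vanishes ω x.1)
      (hne : ∀ y ∈ L, y.2.flatMap Prod.snd ≠ []) :
      Residue g ω (.nonterminal A) (L.flatMap fun y => y.2.flatMap Prod.snd)

theorem Residue.ne_nil {ω : List g.Idx} {c : Symbol T g.NT} {u : List (Symbol T g.NT)}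
    (h : g.Residue ω c u) : u ≠ [] := by
  induction h with
  | refl => simp
  | rewrite L h hL hL' hne => exact hne
  | push L h hB hpop hL hL' hne ihB ih =>
    intro h0
    rw [List.flatMap_eq_nil_iff] at h0
    obtain _ | ⟨y, L⟩ := L
    · exact ihB rfl
    · exact hne y (by simp) (h0 y (by simp))

theorem PopsTo.derives {f : g.Idx} {c : Symbol T g.NT} {β : List (Symbol T g.NT)}
    (h : g.PopsTo f c β) (ω : List g.Idx) :
    g.Derives [c.attachIndices (f :: ω)] (β.map (Symbol.attachIndices ω)) := by
  cases h with
  | terminal t => exact Relation.ReflTransGen.refl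
  | pop h => exact Relation.ReflTransGen.single (Expands.pop ω h).produces

theorem derives_of_residues {ω : List g.Idx} (L : List (Symbol T g.NT × List (Symbol T g.NT)))
    (hL : ∀ x ∈ L, x.2 ≠ [] →
      g.Derives [x.1.attachIndices ω] (x.2.map (Symbol.attachIndices ω)))
    (hL' : ∀ x ∈ L, x.2 = [] → g.Vanishes ω x.1) :
    g.Derives ((L.map Prod.fst).map (Symbol.attachIndices ω))
      ((L.flatMap Prod.snd).map (Symbol.attachIndices ω)) := by
  rw [List.map_map, List.map_flatMap]
  refine Derives.flatMap L fun x hx => ?_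
  by_cases h : x.2 = []
  · have := (hL' x hx h).derives
    rwa [h]
  · exact hL x hx h

theorem Residue.derives {ω : List g.Idx} {c : Symbol T g.NT} {u : List (Symbol T g.NT)}
    (h : g.Residue ω c u) :
    g.Derives [c.attachIndices ω] (u.map (Symbol.attachIndices ω)) := by
  induction h with
  | refl => exact Relation.ReflTransGen.refl
  | rewrite L h hL hL' hne ih =>
    exact Relation.ReflTransGen.head (Expands.rewrite _ h).produces (derives_of_residues L ih hL')
  | push L h hB hpop hL hL' hne ihB ih =>
    refine Relation.ReflTransGen.head (Expands.push _ h).produces (Relation.ReflTransGen.trans ihB ?_)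
    rw [List.map_map, List.map_flatMap]
    exact Derives.flatMap L fun y hy => ((hpop y hy).derives _).trans
      (derives_of_residues y.2 (ih y hy) (hL' y hy))

/-- The string ω is never read, so it matters only when a letter is erased. A push changes the
string to `f :: ω`, where `vanishes_append_of_forall` transfers the hypothesis. -/
theorem Residue.of_vanishes {ω : List g.Idx} {c : Symbol T g.NT} {u : List (Symbol T g.NT)}
    (h : g.Residue ω c u) : ∀ {ω' : List g.Idx}, (∀ c, g.Vanishes ω c → g.Vanishes ω' c) →
      g.Residue ω' c u := by
  induction h with
  | refl => exact fun _ => .refl _ _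
  | rewrite L h hL hL' hne ih =>
    exact fun hv => .rewrite L h (fun x hx h0 => ih x hx h0 hv)
      (fun x hx h0 => hv _ (hL' x hx h0)) hne
  | push L h hB hpop hL hL' hne ihB ih =>
    exact fun hv => .push L h (ihB (vanishes_append_of_forall hv [_])) hpop
      (fun y hy x hx h0 => ih y hy x hx h0 hv) (fun y hy x hx h0 => hv _ (hL' y hy x hx h0)) hne

/-! ### Every nonempty yield factors through a residue -/

/-- `w` arises from the letter `c` with index string `ω` by a residue each of whose letters
derives a nonempty word as described by `Q`. -/
def Factors (g : IndexedGrammar T) {W : Type*} (ω : List g.Idx)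
    (Q : Symbol T g.NT → List W → Prop) (c : Symbol T g.NT) (w : List W) : Prop :=
  ∃ L : List (Symbol T g.NT × List W), g.Residue ω c (L.map Prod.fst) ∧
    L.flatMap Prod.snd = w ∧ ∀ y ∈ L, y.2 ≠ [] ∧ Q y.1 y.2

theorem Factors.ne_nil {W : Type*} {ω : List g.Idx} {Q : Symbol T g.NT → List W → Prop}
    {c : Symbol T g.NT} {w : List W} (h : g.Factors ω Q c w) : w ≠ [] := by
  obtain ⟨L, hL, rfl, hQ⟩ := h
  obtain _ | ⟨y, L⟩ := L
  · exact absurd rfl hL.ne_nil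
  · intro h0
    exact (hQ y (by simp)).1 (List.flatMap_eq_nil_iff.1 h0 y (by simp))

/-- A choice of factorizations for all words, where the empty word gets the empty one. -/
theorem exists_factorization {W : Type*} (ω : List g.Idx) (Q : Symbol T g.NT → List W → Prop) :
    ∃ F : Symbol T g.NT × List W → List (Symbol T g.NT × List W),
      ∀ x, (x.2 ≠ [] → g.Factors ω Q x.1 x.2) →
        (x.2 ≠ [] → g.Residue ω x.1 ((F x).map Prod.fst)) ∧ (F x).flatMap Prod.snd = x.2 ∧
        (∀ y ∈ F x, y.2 ≠ [] ∧ Q y.1 y.2) ∧ ((F x).map Prod.fst = [] ↔ x.2 = []) := by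
  suffices h : ∀ x : Symbol T g.NT × List W, ∃ l : List (Symbol T g.NT × List W),
      (x.2 ≠ [] → g.Factors ω Q x.1 x.2) →
        (x.2 ≠ [] → g.Residue ω x.1 (l.map Prod.fst)) ∧ l.flatMap Prod.snd = x.2 ∧
        (∀ y ∈ l, y.2 ≠ [] ∧ Q y.1 y.2) ∧ (l.map Prod.fst = [] ↔ x.2 = []) from
    Classical.skolem.1 h
  intro x
  by_cases hx : x.2 = []
  · exact ⟨[], fun _ => by simp [hx]⟩
  by_cases hF : g.Factors ω Q x.1 x.2
  · obtain ⟨L, h1, h2, h3⟩ := hF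
    exact ⟨L, fun _ => ⟨fun _ => h1, h2, h3, by simpa [hx] using h1.ne_nil⟩⟩
  · exact ⟨[], fun h => absurd (h hx) hF⟩

theorem Factors.rewrite {W : Type*} {ω : List g.Idx} {Q : Symbol T g.NT → List W → Prop}
    {A : g.NT} (L : List (Symbol T g.NT × List W))
    (h : IndexedRule.rewrite A (L.map Prod.fst) ∈ g.rules)
    (hL : ∀ x ∈ L, x.2 ≠ [] → g.Factors ω Q x.1 x.2)
    (hL' : ∀ x ∈ L, x.2 = [] → g.Vanishes ω x.1) (hne : L.flatMap Prod.snd ≠ []) :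
    g.Factors ω Q (.nonterminal A) (L.flatMap Prod.snd) := by
  obtain ⟨F, hF⟩ := exists_factorization ω Q
  refine ⟨L.flatMap F, ?_, ?_, ?_⟩
  · have := Residue.rewrite (ω := ω) (A := A) (L.map fun x => (x.1, (F x).map Prod.fst))
      (by simpa [Function.comp_def] using h) ?_ ?_ ?_
    · simpa [List.flatMap_map, List.map_flatMap] using this
    · simp only [List.mem_map, forall_exists_index, and_imp]
      rintro _ x hx rfl h0
      obtain ⟨h1, -, -, h4⟩ := hF x (hL x hx)
      exact h1 (fun h5 => h0 (h4.2 h5))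
    · simp only [List.mem_map, forall_exists_index, and_imp]
      rintro _ x hx rfl h0
      exact hL' x hx ((hF x (hL x hx)).2.2.2.1 h0)
    · rw [List.flatMap_map]
      intro h0
      rw [List.flatMap_eq_nil_iff] at h0
      exact hne (List.flatMap_eq_nil_iff.2 fun x hx => (hF x (hL x hx)).2.2.2.1 (h0 x hx))
  · rw [List.flatMap_assoc]
    exact List.flatMap_congr fun x hx => (hF x (hL x hx)).2.1
  · intro y hy
    obtain ⟨x, hx, hy⟩ := List.mem_flatMap.1 hy
    exact (hF x (hL x hx)).2.2.1 y hy

/-- The inner condition says that each letter left by `B` loses `f` and is then factored over `ω`;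
splicing these factorizations gives one residue over `ω`. -/
theorem Factors.push {W : Type*} {ω : List g.Idx} {Q : Symbol T g.NT → List W → Prop}
    {A B : g.NT} {f : g.Idx} (h : IndexedRule.push A B f ∈ g.rules) {w : List W}
    (hB : g.Factors (f :: ω) (fun c v => ∃ L : List (Symbol T g.NT × List W),
      g.PopsTo f c (L.map Prod.fst) ∧ L.flatMap Prod.snd = v ∧
      ∀ x ∈ L, (x.2 ≠ [] → g.Factors ω Q x.1 x.2) ∧ (x.2 = [] → g.Vanishes ω x.1))
      (.nonterminal B) w) :
    g.Factors ω Q (.nonterminal A) w := by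
  obtain ⟨F, hF⟩ := exists_factorization ω Q
  obtain ⟨M, hM, rfl, hQ⟩ := hB
  choose! G hG using fun y hy => (hQ y hy).2
  refine ⟨M.flatMap fun y => (G y).flatMap F, ?_, ?_, ?_⟩
  · have := Residue.push (ω := ω) (M.map fun y => (y.1, (G y).map fun x => (x.1, (F x).map Prod.fst)))
      h (by simpa [Function.comp_def] using hM) ?_ ?_ ?_ ?_
    · simpa [List.flatMap_map, List.map_flatMap] using this
    · simp only [List.mem_map, forall_exists_index, and_imp]
      rintro _ y hy rfl
      simpa [Function.comp_def] using (hG y hy).1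
    · simp only [List.mem_map, forall_exists_index, and_imp]
      rintro _ y hy rfl
      simp only [List.mem_map, forall_exists_index, and_imp]
      rintro _ x hx rfl h0
      obtain ⟨h1, -, -, h4⟩ := hF x ((hG y hy).2.2 x hx).1
      exact h1 (fun h5 => h0 (h4.2 h5))
    · simp only [List.mem_map, forall_exists_index, and_imp]
      rintro _ y hy rfl
      simp only [List.mem_map, forall_exists_index, and_imp]
      rintro _ x hx rfl h0
      obtain ⟨-, -, -, h4⟩ := hF x ((hG y hy).2.2 x hx).1
      exact ((hG y hy).2.2 x hx).2 (h4.1 h0)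
    · simp only [List.mem_map, forall_exists_index, and_imp]
      rintro _ y hy rfl h0
      rw [List.flatMap_map, List.flatMap_eq_nil_iff] at h0
      refine (hQ y hy).1 ?_
      rw [← (hG y hy).2.1, List.flatMap_eq_nil_iff]
      exact fun x hx => (hF x ((hG y hy).2.2 x hx).1).2.2.2.1 (h0 x hx)
  · rw [List.flatMap_assoc]
    refine List.flatMap_congr fun y hy => ?_
    rw [← (hG y hy).2.1, List.flatMap_assoc]
    exact List.flatMap_congr fun x hx => (hF x ((hG y hy).2.2 x hx).1).2.1
  · intro z hz
    obtain ⟨y, hy, hz⟩ := List.mem_flatMap.1 hz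
    obtain ⟨x, hx, hz⟩ := List.mem_flatMap.1 hz
    exact (hF x ((hG y hy).2.2 x hx).1).2.2.1 z hz

/-- `g.PopYield ω c w`: the letter `c` with index string `ω` derives `w` by first consuming the
top index of `ω`, or `c` is a terminal. -/
def PopYield (g : IndexedGrammar T) : List g.Idx → Symbol T g.NT → List T → Prop
  | [], c, w => ∃ t, c = .terminal t ∧ w = [t]
  | f :: ω, c, w => ∃ L : List (Symbol T g.NT × List T),
      g.PopsTo f c (L.map Prod.fst) ∧ L.flatMap Prod.snd = w ∧
      ∀ x ∈ L, (x.2 ≠ [] → g.Factors ω (g.PopYield ω) x.1 x.2) ∧ (x.2 = [] → g.Vanishes ω x.1)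

theorem Factors.of_single {W : Type*} {ω : List g.Idx} {Q : Symbol T g.NT → List W → Prop}
    {c : Symbol T g.NT} {w : List W} (hw : w ≠ []) (h : Q c w) : g.Factors ω Q c w :=
  ⟨[(c, w)], .refl ω c, by simp, by simpa using ⟨hw, h⟩⟩

theorem popYield_terminal (t : T) : ∀ ω : List g.Idx, g.PopYield ω (.terminal t) [t]
  | [] => ⟨t, rfl, rfl⟩
  | f :: ω => ⟨[(.terminal t, [t])], .terminal t, by simp, by
      simpa using Factors.of_single (by simp) (popYield_terminal t ω)⟩

/-- Cut the tree along the nodes at which the top index of ω is first consumed: the part above the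
cut is the residue, the parts below give `PopYield`. -/
theorem Yield.factors {s : Symbol T (g.NT × List g.Idx)} {w : List T} (h : g.Yield s w) :
    ∀ (ω : List g.Idx) (c : Symbol T g.NT), s = c.attachIndices ω → w ≠ [] →
      g.Factors ω (g.PopYield ω) c w := by
  induction h with
  | terminal t =>
    intro ω c hc hw
    obtain t' | A := c
    · obtain rfl : t = t' := by simpa [Symbol.attachIndices] using hc
      exact Factors.of_single hw (popYield_terminal t ω)
    · simp [Symbol.attachIndices] at hc
  | @expand A ω γ L hA hγ hL ih =>
    intro ω' c hc hw
    obtain _ | A := c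
    · simp [Symbol.attachIndices] at hc
    simp only [Symbol.attachIndices, Symbol.nonterminal.injEq, Prod.mk.injEq] at hc
    obtain ⟨rfl, rfl⟩ := hc
    have lift : ∀ (α : List (Symbol T g.NT)) (δ : List g.Idx),
        α.map (Symbol.attachIndices δ) = γ → ∃ L' : List (Symbol T g.NT × List T),
          L'.map Prod.fst = α ∧ L'.flatMap Prod.snd = L.flatMap Prod.snd ∧
          ∀ x ∈ L', (x.2 ≠ [] → g.Factors δ (g.PopYield δ) x.1 x.2) ∧
            (x.2 = [] → g.Vanishes δ x.1) := by
      intro α δ hα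
      have hlen : α.length = L.length := by simpa [← hγ] using congrArg List.length hα
      refine ⟨α.zip (L.map Prod.snd), List.map_fst_zip (by simp [hlen]), ?_, ?_⟩
      · rw [List.flatMap_def, List.map_snd_zip (by simp [hlen]), List.flatMap_def]
      · have hzip : ∀ x ∈ α.zip (L.map Prod.snd), (x.1.attachIndices δ, x.2) ∈ L := by
          intro x hx
          have h1 : (α.map (Symbol.attachIndices δ)).zip (L.map Prod.snd) = L := by
            rw [hα, ← hγ]
            exact (List.zip_of_prod rfl rfl).symm
          rw [← h1, List.zip_map_left]
          exact List.mem_map.2 ⟨x, hx, rfl⟩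
        exact fun x hx => ⟨fun h0 => ih _ (hzip x hx) δ x.1 rfl h0, fun h0 => by
          have := hL _ (hzip x hx)
          rwa [h0] at this⟩
    cases hA with
    | @rewrite α _ hr =>
      obtain ⟨L', rfl, h2, h3⟩ := lift α ω rfl
      rw [← h2] at hw ⊢
      exact Factors.rewrite L' hr (fun x hx => (h3 x hx).1) (fun x hx => (h3 x hx).2) hw
    | @push B f _ hr =>
      obtain ⟨L', h1, h2, h3⟩ := lift [.nonterminal B] (f :: ω) rfl
      obtain ⟨x, rfl, hx⟩ := List.map_eq_singleton_iff.1 h1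
      simp only [List.flatMap_cons, List.flatMap_nil, List.append_nil] at h2
      rw [← h2] at hw ⊢
      exact Factors.push hr (hx ▸ (h3 x (by simp)).1 hw)
    | @pop f α δ hr =>
      obtain ⟨L', rfl, h2, h3⟩ := lift α δ rfl
      exact Factors.of_single hw ⟨L', .pop hr, h2, h3⟩

/-- With no index left to consume, `PopYield` forces every letter of the residue to be a terminal.
-/
theorem residue_of_mem_language {w : List T} (hw : w ∈ g.language) (hne : w ≠ []) :
    g.Residue [] (.nonterminal g.initial) (w.map Symbol.terminal) := by
  obtain ⟨M, h1, rfl, h3⟩ := Derives.exists_yield hw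
  obtain ⟨x, rfl, hx⟩ := List.map_eq_singleton_iff.1 h1
  have hy := h3 x (by simp)
  simp only [List.flatMap_cons, List.flatMap_nil, List.append_nil] at hne ⊢
  obtain ⟨L, hL, hw, hQ⟩ := hy.factors [] (.nonterminal g.initial) hx hne
  convert hL using 1
  rw [← hw, List.map_flatMap, ← List.flatMap_singleton' (L.map Prod.fst), List.flatMap_map]
  refine List.flatMap_congr fun y hy => ?_
  obtain ⟨t, h4, h5⟩ := (hQ y hy).2
  simp [h4, h5]

theorem mem_language_of_residue {w : List T}
    (h : g.Residue [] (.nonterminal g.initial) (w.map Symbol.terminal)) : w ∈ g.language := by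
  have := h.derives
  rw [List.map_map] at this
  exact this

/-! ### Shrinking -/

theorem exists_residue_bound (g : IndexedGrammar T) [Finite T] :
    ∃ K : ℕ, ∀ (ω : List g.Idx) (c : Symbol T g.NT) (l : List (Symbol T g.NT × Bool)),
      g.Residue ω c (l.map Prod.fst) → (∃ x ∈ l, x.2 = true) →
      ∃ l' : List (Symbol T g.NT × Bool), l'.Sublist l ∧ l'.length ≤ K ∧
        g.Residue ω c (l'.map Prod.fst) ∧ ∃ x ∈ l', x.2 = true := by
  have := g.finite_NT
  have hfin : Finite (Symbol T g.NT) :=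
    Finite.of_injective (β := T ⊕ g.NT)
      (fun c => match c with | .terminal t => .inl t | .nonterminal A => .inr A)
      (by rintro (_ | _) (_ | _) h <;> simp_all)
  -- One set of marked words for each letter and each set of vanishing letters: a finite family, so
  -- the Higman bounds have a maximum.
  let Q : Symbol T g.NT × Set (Symbol T g.NT) → Set (List (Symbol T g.NT × Bool)) := fun i =>
    {l | (∃ ω, {c | g.Vanishes ω c} = i.2 ∧ g.Residue ω i.1 (l.map Prod.fst)) ∧
      ∃ x ∈ l, x.2 = true}
  choose K hK using fun i => List.exists_bound_sublist_mem (Q i)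
  obtain ⟨B, hB⟩ := (Set.finite_range K).bddAbove
  refine ⟨B, fun ω c l hl hx => ?_⟩
  obtain ⟨l', ⟨⟨ω', hω', hl'⟩, hx'⟩, hsub, hlen⟩ :=
    hK (c, {c | g.Vanishes ω c}) l ⟨⟨ω, rfl, hl⟩, hx⟩
  exact ⟨l', hsub, hlen.trans (hB ⟨_, rfl⟩),
    hl'.of_vanishes fun c hc => (Set.ext_iff.1 hω' c).1 hc, hx'⟩

/-- Mark the heaviest letter. It carries at least the average weight, and the bounded residue that
keeps it has length at most `K`. -/
theorem exists_shrinks_of_length_le {K K' : ℕ} {ω : List g.Idx} {c : Symbol T g.NT}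
    (hK : ∀ l : List (Symbol T g.NT × Bool),
      g.Residue ω c (l.map Prod.fst) → (∃ x ∈ l, x.2 = true) →
      ∃ l' : List (Symbol T g.NT × Bool), l'.Sublist l ∧ l'.length ≤ K ∧
        g.Residue ω c (l'.map Prod.fst) ∧ ∃ x ∈ l', x.2 = true)
    {X : Type*} (p : X → Symbol T g.NT) (wt : X → ℕ) (v : List X)
    (hv : g.Residue ω c (v.map p)) (h : K < v.length) (h' : v.length ≤ K') :
    ∃ v', List.Shrinks K' wt v v' ∧ g.Residue ω c (v'.map p) := by
  obtain ⟨x, hx, hsum⟩ := List.exists_sum_map_le_length_mul wt v (List.ne_nil_of_length_pos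
    (by omega))
  obtain ⟨a, b, rfl⟩ := List.append_of_mem hx
  let m : List (X × Bool) := a.map (·, false) ++ (x, true) :: b.map (·, false)
  have hm : m.map Prod.fst = a ++ x :: b := by simp [m, Function.comp_def]
  have hmp : ∀ m : List (X × Bool),
      (m.map (Prod.map p id)).map Prod.fst = (m.map Prod.fst).map p := by simp
  obtain ⟨l', hsub, hlen, hl', y, hy, hy'⟩ := hK (m.map (Prod.map p id))
    (by rwa [hmp, hm]) ⟨(p x, true), by simp [m], rfl⟩
  obtain ⟨m', hm', rfl⟩ := List.sublist_map_iff.1 hsub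
  obtain ⟨z, hz, rfl⟩ := List.mem_map.1 hy
  have hzx : z.1 = x := by
    have h1 := hm'.subset hz
    simp only [m, List.mem_append, List.mem_map, List.mem_cons] at h1
    rcases h1 with ⟨_, _, rfl⟩ | rfl | ⟨_, _, rfl⟩
    · simp at hy'
    · rfl
    · simp at hy'
  have hwt : wt x ≤ ((m'.map Prod.fst).map wt).sum :=
    List.single_le_sum (by simp) _ (List.mem_map_of_mem (hzx ▸ List.mem_map_of_mem hz))
  refine ⟨m'.map Prod.fst, ⟨hm ▸ hm'.map Prod.fst, ?_, ?_⟩, by rwa [hmp] at hl'⟩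
  · simp only [List.length_map] at hlen ⊢
    omega
  · exact hsum.trans (Nat.mul_le_mul h' hwt)

theorem exists_rule_bound (g : IndexedGrammar T) :
    ∃ M : ℕ, 1 ≤ M ∧ (∀ A β, IndexedRule.rewrite A β ∈ g.rules → β.length ≤ M) ∧
      ∀ f c β, g.PopsTo f c β → β.length ≤ M := by
  let size : IndexedRule T g.NT g.Idx → ℕ := fun r =>
    match r with
    | .rewrite _ β => β.length
    | .push _ _ _ => 0
    | .pop _ _ β => β.length
  have h : ∀ r ∈ g.rules, size r ≤ g.rules.sup size + 1 := fun r hr =>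
    (Finset.le_sup (f := size) hr).trans (Nat.le_succ _)
  refine ⟨g.rules.sup size + 1, by omega, fun A β hβ => h _ hβ, fun f c β hβ => ?_⟩
  cases hβ with
  | terminal t => simp
  | pop hr => exact h _ hr

universe u

/-- Induction on the residue, arbitrary weights and labels being needed because a push reduces to
the residue of `B`, whose letters expand to blocks of different weights. There the labels are the
blocks themselves, hence `X` ranges over the universe of `T`. -/
theorem Residue.exists_shrinks {T : Type u} {g : IndexedGrammar T} {K M : ℕ}
    (hK : ∀ (ω : List g.Idx) (c : Symbol T g.NT) (l : List (Symbol T g.NT × Bool)),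
      g.Residue ω c (l.map Prod.fst) → (∃ x ∈ l, x.2 = true) →
      ∃ l' : List (Symbol T g.NT × Bool), l'.Sublist l ∧ l'.length ≤ K ∧
        g.Residue ω c (l'.map Prod.fst) ∧ ∃ x ∈ l', x.2 = true)
    (hK1 : 1 ≤ K) (hM1 : 1 ≤ M)
    (hM : ∀ A β, IndexedRule.rewrite A β ∈ g.rules → β.length ≤ M)
    (hM' : ∀ f c β, g.PopsTo f c β → β.length ≤ M)
    {ω : List g.Idx} {c : Symbol T g.NT} {u : List (Symbol T g.NT)} (h : g.Residue ω c u) :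
    ∀ {X : Type u} (p : X → Symbol T g.NT) (wt : X → ℕ) (v : List X), v.map p = u →
      K < v.length → ∃ v', List.Shrinks (K * (M * K)) wt v v' ∧ g.Residue ω c (v'.map p) := by
  have hKMK : 1 ≤ K * (M * K) := Nat.mul_pos hK1 (Nat.mul_pos hM1 hK1)
  induction h with
  | refl ω c =>
    intro X p wt v hv hlen
    have := congrArg List.length hv
    simp only [List.length_map, List.length_singleton] at this
    omega
  | @rewrite ω A L h hL hL' hne ih =>
    intro X p wt v hv hlen
    by_cases hbig : v.length ≤ K * (M * K)
    · exact exists_shrinks_of_length_le (hK _ _) p wt v (hv ▸ .rewrite L h hL hL' hne) hlen hbig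
    obtain ⟨L, rfl, rfl⟩ := List.exists_labels_of_map_eq_flatMap_snd L v hv
    -- Otherwise at most `M` pieces of length at most `K` would make up `v`.
    obtain ⟨x, hx, hxK⟩ : ∃ x ∈ L, K < x.2.length := by
      by_contra! hsmall
      have h1 := List.length_flatMap_le L hsmall
      have h2 := hM _ _ h
      simp only [List.length_map] at h2
      have h3 := Nat.mul_le_mul_right K h2
      have h4 := Nat.mul_le_mul_right (M * K) hK1
      omega
    obtain ⟨v', hv', hres⟩ := ih _ (List.mem_map_of_mem hx)
      (by simpa using List.ne_nil_of_length_pos (by omega : 0 < x.2.length)) p wt x.2 rfl hxK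
    have hv'0 : v' ≠ [] := by simpa using hres.ne_nil
    obtain ⟨a, b, rfl⟩ := List.append_of_mem hx
    refine ⟨(a ++ (x.1, v') :: b).flatMap Prod.snd, ?_, ?_⟩
    · simpa using hv'.append hKMK (a.flatMap Prod.snd) (b.flatMap Prod.snd)
    · have := Residue.rewrite (ω := ω) (A := A) ((a ++ (x.1, v') :: b).map (Prod.map id (List.map p)))
        (by simpa using h) ?_ ?_ ?_
      · simpa [List.flatMap_map, List.map_flatMap] using this
      · intro y hy h0
        simp only [List.map_append, List.map_cons, List.mem_append, List.mem_cons] at hy hL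
        rcases hy with hy | rfl | hy
        · exact hL y (.inl hy) h0
        · exact hres
        · exact hL y (.inr (.inr hy)) h0
      · intro y hy h0
        simp only [List.map_append, List.map_cons, List.mem_append, List.mem_cons] at hy hL'
        rcases hy with hy | rfl | hy
        · exact hL' y (.inl hy) h0
        · exact absurd h0 hres.ne_nil
        · exact hL' y (.inr (.inr hy)) h0
      · simp [hv'0]
  | @push ω A B f L h hB hpop hL hL' hne ihB ih =>
    intro X p wt v hv hlen
    by_cases hbig : v.length ≤ K * (M * K)
    · exact exists_shrinks_of_length_le (hK _ _) p wt v (hv ▸ .push L h hB hpop hL hL' hne) hlen hbig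
    obtain ⟨L, rfl, rfl⟩ := List.exists_flatMap_of_map_eq
      (κ := Symbol T g.NT × List (Symbol T g.NT × List X))
      (F := Prod.map id (List.map (Prod.map id (List.map p))))
      (G := fun y => y.2.flatMap Prod.snd)
      (fun i w hw => by
        obtain ⟨l, hl, hl'⟩ := List.exists_labels_of_map_eq_flatMap_snd i.2 w hw
        exact ⟨(i.1, l), Prod.ext rfl hl, hl'⟩) L v hv
    have hnil : ∀ l : List (Symbol T g.NT × List X),
        (l.map (Prod.map id (List.map p))).flatMap Prod.snd = (l.flatMap Prod.snd).map p := by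
      simp [List.flatMap_map, List.map_flatMap]
    simp only [List.forall_mem_map, Prod.map_fst, Prod.map_snd, id, hnil, ne_eq,
      List.map_eq_nil_iff, List.map_map, Prod.map_fst', Function.id_comp] at hB hpop hL hL' hne ihB ih
    -- Reassembles a residue of `A` from any modified list of blocks, serving both cases below.
    have build : ∀ L' : List (Symbol T g.NT × List (Symbol T g.NT × List X)),
        g.Residue (f :: ω) (.nonterminal B) (L'.map Prod.fst) →
        (∀ y ∈ L', g.PopsTo f y.1 (y.2.map Prod.fst) ∧ y.2.flatMap Prod.snd ≠ [] ∧
          ∀ x ∈ y.2, (x.2 ≠ [] → g.Residue ω x.1 (x.2.map p)) ∧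
            (x.2 = [] → g.Vanishes ω x.1)) →
        g.Residue ω (.nonterminal A) ((L'.flatMap fun y => y.2.flatMap Prod.snd).map p) := by
      intro L' h1 h2
      have := Residue.push (ω := ω) (L'.map (Prod.map id (List.map (Prod.map id (List.map p))))) h
        (by simpa only [List.map_map, Prod.map_fst', Function.id_comp] using h1) ?_ ?_ ?_ ?_
      · simpa only [List.flatMap_map, List.map_flatMap, Prod.map_snd] using this
      all_goals simp only [List.forall_mem_map, Prod.map_fst, Prod.map_snd, id, hnil, ne_eq,
        List.map_eq_nil_iff, List.map_map, Prod.map_fst', Function.id_comp]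
      · exact fun y hy => (h2 y hy).1
      · exact fun y hy x hx => ((h2 y hy).2.2 x hx).1
      · exact fun y hy x hx => ((h2 y hy).2.2 x hx).2
      · exact fun y hy => (h2 y hy).2.1
    -- If the residue of `B` is long, shrink it with block weights; otherwise some residue inside a
    -- block is long, since `K` blocks of `M` pieces of length `K` would give only `K * (M * K)`.
    by_cases hLK : K < L.length
    · obtain ⟨L', hs, hres⟩ := ihB (X := Symbol T g.NT × List (Symbol T g.NT × List X)) Prod.fst
        (fun y => ((y.2.flatMap Prod.snd).map wt).sum) L (by simp) hLK
      refine ⟨L'.flatMap fun y => y.2.flatMap Prod.snd, hs.flatMap hne, build L' hres ?_⟩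
      intro y hy
      have hy' := hs.sublist.subset hy
      exact ⟨hpop y hy', hne y hy', fun x hx => ⟨hL y hy' x hx, hL' y hy' x hx⟩⟩
    · obtain ⟨y, hy, x, hx, hxK⟩ : ∃ y ∈ L, ∃ x ∈ y.2, K < x.2.length := by
        by_contra! hsmall
        have h1 : (L.flatMap fun y => y.2.flatMap Prod.snd).length ≤ L.length * (M * K) := by
          refine List.length_flatMap_le L fun y hy => ?_
          have h2 := List.length_flatMap_le y.2 (hsmall y hy)
          have h3 := hM' _ _ _ (hpop y hy)
          rw [List.length_map] at h3
          exact h2.trans (Nat.mul_le_mul_right K h3)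
        have h2 := Nat.mul_le_mul_right (M * K) (not_lt.1 hLK)
        omega
      obtain ⟨v', hv', hres⟩ := ih y hy x hx
        (List.ne_nil_of_length_pos (by omega)) p wt x.2 rfl hxK
      have hv'0 : v' ≠ [] := by simpa using hres.ne_nil
      obtain ⟨a, b, rfl⟩ := List.append_of_mem hy
      obtain ⟨y, l⟩ := y
      obtain ⟨a', b', rfl⟩ := List.append_of_mem hx
      have old : ∀ z ∈ a ++ (y, a' ++ x :: b') :: b,
          g.PopsTo f z.1 (z.2.map Prod.fst) ∧ z.2.flatMap Prod.snd ≠ [] ∧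
          ∀ x ∈ z.2, (x.2 ≠ [] → g.Residue ω x.1 (x.2.map p)) ∧
            (x.2 = [] → g.Vanishes ω x.1) := fun z hz =>
        ⟨hpop z hz, hne z hz, fun x hx => ⟨hL z hz x hx, hL' z hz x hx⟩⟩
      refine ⟨(a ++ (y, a' ++ (x.1, v') :: b') :: b).flatMap fun y => y.2.flatMap Prod.snd, ?_,
        build _ (by simpa using hB) ?_⟩
      · have := (hv'.append hKMK (a'.flatMap Prod.snd) (b'.flatMap Prod.snd)).append hKMK
          (a.flatMap fun y => y.2.flatMap Prod.snd) (b.flatMap fun y => y.2.flatMap Prod.snd)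
        simpa using this
      · intro z hz
        simp only [List.mem_append, List.mem_cons] at hz old
        rcases hz with hz | rfl | hz
        · exact old z (.inl hz)
        · obtain ⟨h1, -, h3⟩ := old _ (.inr (.inl rfl))
          refine ⟨by simpa using h1, by simp [hv'0], ?_⟩
          intro z hz
          simp only [List.mem_append, List.mem_cons] at hz h3
          rcases hz with hz | rfl | hz
          · exact h3 z (.inl hz)
          · exact ⟨fun _ => hres, fun h0 => absurd h0 hv'0⟩
          · exact h3 z (.inr (.inr hz))
        · exact old z (.inr (.inr hz))

/-- Every sufficiently long word of an indexed language has a proper subword in the language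
which is shorter by at most a constant factor. -/
theorem exists_sublist_mem_language [Finite T] (g : IndexedGrammar T) :
    ∃ K : ℕ, ∀ w ∈ g.language, K < w.length → ∃ w' ∈ g.language,
      w'.Sublist w ∧ w'.length < w.length ∧ w.length ≤ K * w'.length := by
  obtain ⟨K, hK⟩ := g.exists_residue_bound
  obtain ⟨M, hM1, hM, hM'⟩ := g.exists_rule_bound
  have hK' : ∀ (ω : List g.Idx) (c : Symbol T g.NT) (l : List (Symbol T g.NT × Bool)),
      g.Residue ω c (l.map Prod.fst) → (∃ x ∈ l, x.2 = true) →
      ∃ l' : List (Symbol T g.NT × Bool), l'.Sublist l ∧ l'.length ≤ K + 1 ∧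
        g.Residue ω c (l'.map Prod.fst) ∧ ∃ x ∈ l', x.2 = true := by
    intro ω c l h1 h2
    obtain ⟨l', h3, h4, h5⟩ := hK ω c l h1 h2
    exact ⟨l', h3, h4.trans (Nat.le_succ K), h5⟩
  refine ⟨(K + 1) * (M * (K + 1)), fun w hw hlen => ?_⟩
  have hle : K + 1 ≤ (K + 1) * (M * (K + 1)) :=
    Nat.le_mul_of_pos_right _ (Nat.mul_pos hM1 K.succ_pos)
  obtain ⟨w', hs, hres⟩ := (residue_of_mem_language hw (List.ne_nil_of_length_pos
    (by omega))).exists_shrinks hK' (by omega) hM1 hM hM' Symbol.terminal (fun _ => 1) w rfl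
    (by omega)
  exact ⟨w', mem_language_of_residue hres, hs.sublist, hs.length_lt, by simpa using hs.sum_le⟩

end IndexedGrammar

/-! ### Exponential growth bound -/

theorem corollary3 {T : Type*} [Finite T] (a : T) (f : ℕ+ → ℕ) (hf : StrictMono f)
    (hL : Language.IsIndexed ({w : List T | ∃ n : ℕ+, w = List.replicate (f n) a} : Language T)) :
    ∃ k : ℕ, 0 < k ∧
      (fun n : ℕ+ => (f n : ℝ)) =O[Filter.atTop] (fun n : ℕ+ => (k : ℝ) ^ (n : ℕ)) := by
  obtain ⟨g, hg⟩ := hL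
  obtain ⟨K, hK⟩ := g.exists_sublist_mem_language
  have hmem : ∀ w, w ∈ g.language ↔ ∃ n : ℕ+, w = List.replicate (f n) a := fun w => by
    rw [hg]
    rfl
  -- The summand `K` covers the words too short to be shrunk.
  have hstep : ∀ n : ℕ+, f (n + 1) ≤ K * f n + K := by
    intro n
    by_cases hn : f (n + 1) ≤ K
    · omega
    obtain ⟨w', hw', -, hlt, hle⟩ := hK _ ((hmem _).2 ⟨n + 1, rfl⟩) (by simpa using hn)
    obtain ⟨m, rfl⟩ := (hmem _).1 hw'
    rw [List.length_replicate, List.length_replicate] at hlt hle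
    have hmn : m ≤ n := PNat.lt_add_one_iff.1 (hf.lt_iff_lt.1 hlt)
    have := Nat.mul_le_mul_left K (hf.monotone hmn)
    omega
  -- Adding 1 to f turns the affine recursion into a geometric one of ratio `K + 1`.
  have hbound : ∀ n : ℕ+, f n + 1 ≤ (f 1 + 1) * (K + 1) ^ (n : ℕ) := by
    intro n
    induction n using PNat.recOn with
    | one => exact Nat.le_mul_of_pos_right _ (by positivity)
    | succ n ih =>
      calc f (n + 1) + 1 ≤ (f n + 1) * (K + 1) := by linarith [hstep n]
        _ ≤ (f 1 + 1) * (K + 1) ^ (n : ℕ) * (K + 1) := Nat.mul_le_mul_right _ ih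
        _ = (f 1 + 1) * (K + 1) ^ ((n + 1 : ℕ+) : ℕ) := by
          rw [PNat.add_coe, PNat.one_coe, pow_succ, mul_assoc]
  refine ⟨K + 1, K.succ_pos, Asymptotics.IsBigO.of_bound (f 1 + 1 : ℕ) (.of_forall fun n => ?_)⟩
  have h := (Nat.le_succ _).trans (hbound n)
  rw [Real.norm_of_nonneg (by positivity), Real.norm_of_nonneg (by positivity)]
  exact_mod_cast h
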